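/- For an integer $\alpha$ let $G(\alpha)=\langle A,B\mid A^{[A,B]}=A^{\alpha},\ B^{[B,A]}=B^{\alpha}\rangle$, where $[a,b]=a^{-1}b^{-1}ab$ and $b^a=a^{-1}ba$. Suppose that the $2$-adic valuation of $\alpha-1$ is exactly $1$, and let $J$ be a Sylow $2$-subgroup of $G(\alpha)$. Then $J$ is isomorphic to the generalized quaternion group of order $16$; it is nilpotent of class $3$ and has exponent $8$. Moreover, there is exactly one homomorphism $\pi:G(\alpha)\to J$ that restricts to the identity on $J$ (the projection of $G(\alpha)$ onto its Sylow $2$-subgroup). Writing again $A,B\in J$ for the images under $\pi$ of the generators $A,B$ of $G(\alpha)$, and $C=[A,B]\in J$, we have $$Z(J)=\langle A^2\rangle=\gamma_3(J),\qquad Z_2(J)=\langle A^2,C\rangle=\gamma_2(J),$$ where $Z(J)=Z_1(J)\subseteq Z_2(J)\subseteq\cdots$ is the upper central series of $J$, and $J=\gamma_1(J)\supseteq\gamma_2(J)\supseteq\cdots$, with $\gamma_{i+1}(J)=[J,\gamma_i(J)]$, is its lower central series. -/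

import Mathlib

/-- The commutator `[a, b] = a⁻¹ b⁻¹ a b`
(Mathlib's `⁅a, b⁆` is `a b a⁻¹ b⁻¹`, so it is not used here). -/
def rcomm {T : Type*} [Group T] (a b : T) : T := a⁻¹ * b⁻¹ * a * b

/-- The conjugate `b ^ a = a⁻¹ b a`. -/
def rconj {T : Type*} [Group T] (b a : T) : T := a⁻¹ * b * a

/-- The two relators of the presentation `⟨A, B | A^[A,B] = A^α, B^[B,A] = B^α⟩`,
in the free group on `A = of false` and `B = of true`. -/
def macdonaldRels (α : ℤ) : Set (FreeGroup Bool) :=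
  {rconj (FreeGroup.of false) (rcomm (FreeGroup.of false) (FreeGroup.of true)) *
      (FreeGroup.of false ^ α)⁻¹,
    rconj (FreeGroup.of true) (rcomm (FreeGroup.of true) (FreeGroup.of false)) *
      (FreeGroup.of true ^ α)⁻¹}

/-- The Macdonald group `G(α) = ⟨A, B | A^[A,B] = A^α, B^[B,A] = B^α⟩`. -/
abbrev MacdonaldGroup (α : ℤ) : Type := PresentedGroup (macdonaldRels α)

/-- The generator `A` of `G(α)`. -/
def MacdonaldGroup.genA (α : ℤ) : MacdonaldGroup α := PresentedGroup.of false

/-- The generator `B` of `G(α)`. -/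
def MacdonaldGroup.genB (α : ℤ) : MacdonaldGroup α := PresentedGroup.of true

/-- `π` is a projection of `G` onto its Sylow `p`-subgroup `J`: a homomorphism `G → J` that is the
identity on `J`. Since `J` is a `p`-group, such a `π` automatically kills every Sylow `q`-subgroup
with `q ≠ p`; so when `G` is finite and nilpotent it is precisely the projection attached to
the decomposition of `G` as the direct product of its Sylow subgroups. -/
def IsSylowProjection {p : ℕ} {G : Type*} [Group G] (J : Sylow p G) (π : G →* J) : Prop :=
  ∀ x : J, π (x : G) = x

/-! The hypothesis says `α ≡ 3 (mod 4)`. The order of `J` is bounded above by 16 from the relations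
and below by an explicit quotient; both bounds need `G(α)` to be finite and nilpotent.

Put `C = [A, B]`. Conjugation by `C` raises `A` to the power `x`, conjugation by `C⁻¹` does so to
`B`, and `(A ^ n) ^ B = (A C) ^ n = C ^ n A ^ (x + ⋯ + x ^ n)`. Computing `[A ^ m, B]` and its `C ^
j`-conjugate `[A, B ^ m]`, `m = x ^ j`, gives `B ^ (U x ^ (m + j)) = A ^ (-U)` with `U` explicit
(`zpow_eq`). So `A ^ U` is central and `A ^ (U (x - 1)) = 1`; hence the generators are torsion, and
`α` may be replaced by a positive residue `x`.

Letting `j` vary shows that primes dividing the orders of the generators modulo the centre divide `x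
- 1` (`dvd_sub_one_of_forall_dvd`). Induction on an exponent of the generators then gives nilpotency
(`isNilpotent_of_pow_eq_one`), and torsion generators give finiteness.

In a 2-group quotient, `U` and `x - 1` are twice odd numbers, so `A ^ 4 = B ^ 4 = 1` and `A ^ 2 = B
^ 2`, which leaves at most 16 elements. As `G(α)` maps onto `QuaternionGroup 4`, and in a finite
nilpotent group `J` has the same image in a 2-group as the whole group, `J` is that group. The
series are then computed there by `decide`. -/

/-- `A` and `B` satisfy the defining relations of the Macdonald group `G(x)`. -/
structure IsMacdonaldPair {H : Type*} [Group H] (x : ℤ) (A B : H) : Prop where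
  left : rconj A (rcomm A B) = A ^ x
  right : rconj B (rcomm B A) = B ^ x

/-- The exponent `x + x² + ⋯ + xⁿ`. -/
def powSum (x : ℤ) (n : ℕ) : ℤ := x * ∑ i ∈ Finset.range n, x ^ i

theorem powSum_succ (x : ℤ) (n : ℕ) : powSum x (n + 1) = x * (powSum x n + 1) := by
  rw [powSum, geom_sum_succ, powSum]

theorem sub_one_mul_powSum (x : ℤ) (n : ℕ) : (x - 1) * powSum x n = x * (x ^ n - 1) := by
  rw [powSum, ← mul_geom_sum]; ring

/-! ### Relations between powers of the generators -/

namespace IsMacdonaldPair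

variable {H K : Type*} [Group H] [Group K] {x : ℤ} {A B : H}

theorem rcomm_swap (a b : H) : rcomm b a = (rcomm a b)⁻¹ := by
  simp [rcomm, mul_assoc]

theorem symm (h : IsMacdonaldPair x A B) : IsMacdonaldPair x B A := ⟨h.right, h.left⟩

theorem map (h : IsMacdonaldPair x A B) (f : H →* K) : IsMacdonaldPair x (f A) (f B) := by
  constructor
  · simpa [rconj, rcomm] using congrArg f h.left
  · simpa [rconj, rcomm] using congrArg f h.right

theorem semiconj_left (h : IsMacdonaldPair x A B) : SemiconjBy (rcomm A B) (A ^ x) A := by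
  rw [SemiconjBy, ← h.left, rconj]; group

theorem semiconj_pow_left (h : IsMacdonaldPair x A B) (n : ℕ) (i : ℤ) :
    SemiconjBy (rcomm A B ^ n) (A ^ (i * x ^ n)) (A ^ i) := by
  induction n generalizing i with
  | zero => simp
  | succ n ih =>
    rw [pow_succ]
    refine (ih i).mul_left ?_
    have := h.semiconj_left.zpow_right (i * x ^ n)
    rwa [← zpow_mul, show x * (i * x ^ n) = i * x ^ (n + 1) by ring] at this

theorem semiconj_pow_right (h : IsMacdonaldPair x A B) (n : ℕ) (i : ℤ) :
    SemiconjBy (rcomm A B ^ n) (B ^ i) (B ^ (i * x ^ n)) := by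
  have := h.symm.semiconj_pow_left n i
  rw [rcomm_swap A B, inv_pow] at this
  exact SemiconjBy.inv_symm_left_iff.1 this

theorem conj_pow_left (h : IsMacdonaldPair x A B) (n : ℕ) (i : ℤ) :
    A ^ i * rcomm A B ^ n = rcomm A B ^ n * A ^ (i * x ^ n) :=
  (h.semiconj_pow_left n i).eq.symm

theorem mul_comm_pow (h : IsMacdonaldPair x A B) (n : ℕ) :
    (A * rcomm A B) ^ n = rcomm A B ^ n * A ^ powSum x n := by
  induction n with
  | zero => simp [powSum]
  | succ n ih =>
    have := h.conj_pow_left 1 (powSum x n + 1)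
    rw [pow_one, pow_one] at this
    rw [pow_succ, ih, powSum_succ, mul_comm x, pow_succ, mul_assoc, ← mul_assoc _ A, ← zpow_add_one,
      this, mul_assoc]

theorem conj_eq (A B : H) : B⁻¹ * A * B = A * rcomm A B := by simp [rcomm, mul_assoc]

theorem conj_pow_eq (h : IsMacdonaldPair x A B) (n : ℕ) :
    B⁻¹ * A ^ n * B = rcomm A B ^ n * A ^ powSum x n := by
  rw [← h.mul_comm_pow, ← conj_eq]
  simpa using (conj_pow (a := B⁻¹) (b := A) (i := n)).symm

/-- The common consequence of the power relations. -/
theorem zpow_eq_of_conj (h : IsMacdonaldPair x A B) {U : ℤ} {n : ℕ}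
    (e : B ^ U * rcomm A B ^ n = rcomm A B ^ n * A ^ (-U)) : B ^ (U * x ^ n) = A ^ (-U) := by
  have h1 : B ^ U = rcomm A B ^ n * A ^ (-U) * (rcomm A B ^ n)⁻¹ := eq_mul_inv_of_mul_eq e
  have h2 := (h.semiconj_pow_left n (-U)).eq
  rw [zpow_mul, h1, conj_zpow, ← zpow_mul, h2, mul_inv_cancel_right]

/-- Conjugation by `D⁻¹` carries `P` to `A` and `B` to `Q`, hence `[P, B]` to `[A, Q]`. The
conclusion compares the two evaluations. In the application `D = C ^ j`, `E = C ^ m`, `P = A ^ m`,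
`Q = B ^ m`. -/
theorem conj_relation {A B D E P Q X Y R S : H} (c : Commute D E) (a2 : A * D = D * P)
    (a1 : P * E = E * X) (e1 : B⁻¹ * P * B = E * R) (b1 : D * B = Q * D)
    (b2 : E * D * B = Y * (E * D)) (e2 : A⁻¹ * Q * A = E⁻¹ * S) :
    S⁻¹ * Y * (E * D) = E * D * (X⁻¹ * R) := by
  have hA : A = D * P * D⁻¹ := eq_mul_inv_of_mul_eq a2
  have hQ : Q = D * B * D⁻¹ := eq_mul_inv_of_mul_eq b1.symm
  have hX : X = E⁻¹ * (P * E) := by rw [a1, inv_mul_cancel_left]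
  have hR : R = E⁻¹ * (B⁻¹ * P * B) := by rw [e1, inv_mul_cancel_left]
  have hS : S = E * (A⁻¹ * Q * A) := by rw [e2, mul_inv_cancel_left]
  calc S⁻¹ * Y * (E * D) = D * P⁻¹ * (B⁻¹ * P * B) := by
        rw [mul_assoc, ← b2, hS, hA, hQ]; group
    _ = D * E * (X⁻¹ * R) := by rw [hX, hR]; group
    _ = E * D * (X⁻¹ * R) := by rw [c.eq]

/-- The same comparison for `[P⁻¹, B]` and `[A, Q⁻¹]`, with `P = A ^ a`, `Q = B ^ a`, `E = C ^ a`
and `x = -a`. -/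
theorem conj_relation_of_neg {A B C E P Q R S : H} (c : Commute C E) (a2 : A * C = C * P⁻¹)
    (e1 : B⁻¹ * P⁻¹ * B = R⁻¹ * E⁻¹) (b1 : C * B = Q⁻¹ * C) (e2 : A⁻¹ * Q⁻¹ * A = S⁻¹ * E) :
    S * Q⁻¹ * (E * C) = E * C * (P * R⁻¹) := by
  have hA : A = C * P⁻¹ * C⁻¹ := eq_mul_inv_of_mul_eq a2
  have hQ : Q⁻¹ = C * B * C⁻¹ := eq_mul_inv_of_mul_eq b1.symm
  have hS : S = E * (A⁻¹ * Q⁻¹ * A)⁻¹ := by rw [e2]; group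
  calc S * Q⁻¹ * (E * C) = E * C * P * (B⁻¹ * P⁻¹ * B) * (C⁻¹ * (E * C)) := by
        rw [hS, hA, hQ]; group
    _ = E * C * (P * R⁻¹) := by rw [e1, ← c.eq]; group

/-- The relation between powers of `A` and `B` obtained from `x ^ j` when this is a natural number
`m`. -/
theorem zpow_eq (h : IsMacdonaldPair x A B) {j m : ℕ} (hm : (m : ℤ) = x ^ j) :
    B ^ ((x ^ (m + j) - powSum x m) * x ^ (m + j)) = A ^ (-(x ^ (m + j) - powSum x m)) := by
  apply h.zpow_eq_of_conj
  have e1 := h.conj_pow_eq m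
  have e2 := h.symm.conj_pow_eq m
  rw [rcomm_swap A B] at e2
  have a1 := h.conj_pow_left m m
  have a2 := h.conj_pow_left j 1
  have b1 := (h.semiconj_pow_right j 1).eq
  have b2 := (h.semiconj_pow_right (m + j) 1).eq
  rw [one_mul, ← hm, zpow_natCast] at a2 b1
  rw [zpow_natCast] at a1
  rw [zpow_one] at a2 b1 b2
  rw [one_mul] at b2
  have c := (Commute.refl (rcomm A B)).pow_pow j m
  rw [sub_eq_neg_add, neg_add_rev, neg_neg, zpow_add, zpow_add, zpow_neg, zpow_neg]
  -- Since `m = x ^ j`, the exponent `m * x ^ m` is `x ^ (m + j)`.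
  rw [hm, ← pow_add, add_comm j m] at a1
  rw [pow_add (rcomm A B)] at b2 ⊢
  rw [inv_pow] at e2
  exact conj_relation c a2 a1 e1 b1 b2 e2

/-- The relation between powers of `A` and `B` for a negative `x = -a`. -/
theorem zpow_eq_of_neg (h : IsMacdonaldPair x A B) {a : ℕ} (ha : x = -a) :
    B ^ ((powSum x a + x) * x ^ (a + 1)) = A ^ (-(powSum x a + x)) := by
  apply h.zpow_eq_of_conj
  have e1 := congrArg (·⁻¹) (h.conj_pow_eq a)
  have e2 := congrArg (·⁻¹) (h.symm.conj_pow_eq a)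
  rw [rcomm_swap A B] at e2
  have a2 := h.conj_pow_left 1 1
  have b1 := (h.semiconj_pow_right 1 1).eq
  have hA : A ^ x = (A ^ a)⁻¹ := by rw [ha, zpow_neg, zpow_natCast]
  have hB : B ^ x = (B ^ a)⁻¹ := by rw [ha, zpow_neg, zpow_natCast]
  simp only [one_mul, pow_one, zpow_one] at a2 b1
  rw [zpow_add, neg_add_rev, zpow_add, zpow_neg, zpow_neg, hA, hB, inv_inv, pow_succ]
  rw [hA] at a2
  rw [hB] at b1
  rw [inv_pow] at e2
  simp only [mul_inv_rev, inv_inv, ← mul_assoc] at e1 e2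
  exact conj_relation_of_neg ((Commute.refl _).pow_right a) a2 e1 b1 e2

end IsMacdonaldPair

/-! ### Finiteness of nilpotent groups with two torsion generators -/

theorem Subgroup.closure_map_pair_eq_top {H K : Type*} [Group H] [Group K] {A B : H}
    (hg : Subgroup.closure {A, B} = ⊤) {f : H →* K} (hf : Function.Surjective f) :
    Subgroup.closure {f A, f B} = ⊤ := by
  rw [← Set.image_pair, ← MonoidHom.map_closure, hg, ← MonoidHom.range_eq_map,
    MonoidHom.range_eq_top.2 hf]

open scoped commutatorElement in
/-- A nilpotent group generated by two elements of finite order is finite. -/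
theorem Group.IsNilpotent.finite_of_closure_pair (G : Type*) [Group G] [Group.IsNilpotent G] :
    ∀ a b : G, Subgroup.closure {a, b} = ⊤ → IsOfFinOrder a → IsOfFinOrder b → Finite G := by
  refine Group.nilpotent_center_quotient_ind
    (P := fun G _ _ => ∀ a b : G, Subgroup.closure {a, b} = ⊤ → IsOfFinOrder a →
      IsOfFinOrder b → Finite G) G (fun _ _ _ _ _ _ _ _ => inferInstance) ?_
  intro G _ _ ih a b hab ha hb
  have fin : Finite (G ⧸ Subgroup.center G) :=
    ih _ _ (Subgroup.closure_map_pair_eq_top hab (f := QuotientGroup.mk' _) (QuotientGroup.mk'_surjective _))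
      (MonoidHom.isOfFinOrder _ ha) (MonoidHom.isOfFinOrder _ hb)
  -- A commutator depends only on the cosets of its entries modulo the centre, so there are finitely
  -- many; the derived subgroup is then finite.
  have : Finite (commutatorSet G) := by
    let F : (G ⧸ Subgroup.center G) × (G ⧸ Subgroup.center G) → G := fun p => ⁅p.1.out, p.2.out⁆
    refine Set.Finite.subset (Set.finite_range F) ?_
    rintro _ ⟨g, h, rfl⟩
    refine ⟨(g, h), ?_⟩
    obtain ⟨⟨z, hz⟩, e⟩ := QuotientGroup.mk_out_eq_mul (Subgroup.center G) g
    obtain ⟨⟨w, hw⟩, e'⟩ := QuotientGroup.mk_out_eq_mul (Subgroup.center G) h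
    rw [Subgroup.mem_center_iff] at hz hw
    simp only [F, e, e', commutatorElement_def, mul_inv_rev]
    calc g * z * (h * w) * (z⁻¹ * g⁻¹) * (w⁻¹ * h⁻¹)
        = g * (z * (h * w) * z⁻¹) * g⁻¹ * (w⁻¹ * h⁻¹) := by group
      _ = g * (h * w) * g⁻¹ * (w⁻¹ * h⁻¹) := by rw [← hz, mul_inv_cancel_right]
      _ = g * h * (w * (g⁻¹ * w⁻¹)) * h⁻¹ := by group
      _ = g * h * g⁻¹ * h⁻¹ := by rw [← mul_assoc w, ← hw, mul_inv_cancel_right]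
  have : Finite (Abelianization G) := by
    have hc := Subgroup.closure_map_pair_eq_top hab (f := Abelianization.of) (QuotientGroup.mk'_surjective _)
    have hfa := (MonoidHom.isOfFinOrder (Abelianization.of (G := G)) ha).finite_zpowers
    have hfb := (MonoidHom.isOfFinOrder (Abelianization.of (G := G)) hb).finite_zpowers
    refine Set.finite_univ_iff.1 ((hfa.mul hfb).subset ?_)
    intro y _
    have hy : y ∈ Subgroup.closure {Abelianization.of a, Abelianization.of b} :=
      hc ▸ Subgroup.mem_top y
    obtain ⟨m, n, rfl⟩ := Subgroup.mem_closure_pair.1 hy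
    exact Set.mul_mem_mul ⟨m, rfl⟩ ⟨n, rfl⟩
  have : Finite (G ⧸ commutator G) := ‹Finite (Abelianization G)›
  exact Finite.of_equiv _ (Subgroup.groupEquivQuotientProdSubgroup
    (s := commutator G)).symm

/-! ### Nilpotency when the primes involved divide `x - 1` -/

theorem dvd_geom_sum_of_dvd_sub_one {p : ℕ} {y : ℤ} (h : (p : ℤ) ∣ y - 1) :
    (p : ℤ) ∣ ∑ i ∈ Finset.range p, y ^ i := by
  have h1 : (y : ZMod p) = 1 := by
    have := (ZMod.intCast_zmod_eq_zero_iff_dvd _ _).2 h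
    push_cast at this
    exact sub_eq_zero.1 this
  rw [← ZMod.intCast_zmod_eq_zero_iff_dvd]
  simp [h1]

/-- Each prime factor `p` of `r` contributes a geometric sum of `p` terms congruent to 1 modulo `p`.
-/
theorem mul_sub_one_dvd_pow_sub_one {x : ℤ} (r : ℕ)
    (hr : ∀ p : ℕ, p.Prime → p ∣ r → (p : ℤ) ∣ x - 1) : (r : ℤ) * (x - 1) ∣ x ^ r - 1 := by
  induction r using induction_on_primes with
  | zero => simp
  | one => simp
  | prime_mul p a hp ih =>
    have h1 := ih fun q hq hqa => hr q hq (hqa.mul_left p)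
    have h2 : (p : ℤ) ∣ x ^ a - 1 :=
      (hr p hp (dvd_mul_right p a)).trans (sub_one_dvd_pow_sub_one x a)
    rw [mul_comm p a, pow_mul, ← mul_geom_sum (x ^ a) p]
    have := mul_dvd_mul h1 (dvd_geom_sum_of_dvd_sub_one h2)
    rw [Nat.cast_mul, mul_right_comm]
    exact this

theorem dvd_powSum {x : ℤ} {r : ℕ} (hr : ∀ p : ℕ, p.Prime → p ∣ r → (p : ℤ) ∣ x - 1) :
    (r : ℤ) ∣ powSum x r := by
  by_cases hx : x = 1
  · simp [hx, powSum]
  · have := (mul_sub_one_dvd_pow_sub_one r hr).mul_left x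
    rw [← sub_one_mul_powSum, mul_comm] at this
    exact (mul_dvd_mul_iff_left (sub_ne_zero.2 hx)).1 this

/-- An automorphism of order prime to `p - 1` acts trivially on a cyclic group of order `p`. -/
theorem commute_of_conj_eq_zpow {H : Type*} [Group H] {y B : H} {p h : ℕ} [Fact p.Prime] {c : ℤ}
    (hy : y ^ p = 1) (hB : B ^ h = 1) (hc : B⁻¹ * y * B = y ^ c) (hh0 : h ≠ 0)
    (hp : h.Coprime (p - 1)) :
    Commute y B := by
  have key : ∀ n : ℕ, (B ^ n)⁻¹ * y * B ^ n = y ^ c ^ n := by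
    intro n
    induction n with
    | zero => simp
    | succ n ih =>
      have := congrArg (fun t => B⁻¹ * t * B) ih
      have e := (conj_zpow (a := B⁻¹) (b := y) (i := c ^ n)).symm
      rw [inv_inv, hc] at e
      simp only [e, ← zpow_mul, ← pow_succ'] at this
      rw [← this, pow_succ]; group
  by_cases h1 : y = 1
  · rw [h1]; exact Commute.one_left B
  have ho : orderOf y = p := orderOf_eq_prime hy h1
  have hh := key h
  rw [hB, inv_one, one_mul, mul_one] at hh
  have hch : ((c : ZMod p)) ^ h = 1 := by
    have : y ^ (c ^ h - 1) = 1 := by rw [zpow_sub_one, ← hh, mul_inv_cancel]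
    rw [← orderOf_dvd_iff_zpow_eq_one, ho, ← ZMod.intCast_zmod_eq_zero_iff_dvd] at this
    push_cast at this
    exact sub_eq_zero.1 this
  have hc0 : (c : ZMod p) ≠ 0 := by
    intro h0; rw [h0, zero_pow hh0] at hch; exact zero_ne_one hch
  -- The order of `c` divides both `h` and `p - 1`, which are coprime.
  have hc1 : (c : ZMod p) = 1 := by
    rw [← orderOf_eq_one_iff, ← Nat.dvd_one, ← hp]
    exact Nat.dvd_gcd (orderOf_dvd_of_pow_eq_one hch)
      (orderOf_dvd_of_pow_eq_one (ZMod.pow_card_sub_one_eq_one hc0))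
  have : y ^ c = y := by
    have h2 : y ^ (c - 1) = 1 := by
      rw [← orderOf_dvd_iff_zpow_eq_one, ho, ← ZMod.intCast_zmod_eq_zero_iff_dvd]
      push_cast
      rw [hc1, sub_self]
    rwa [zpow_sub_one, mul_inv_eq_one] at h2
  rw [this, mul_assoc] at hc
  exact inv_mul_eq_iff_eq_mul.1 hc

theorem Nat.coprime_minFac_sub_one {h : ℕ} (h1 : h ≠ 1) : h.Coprime (h.minFac - 1) := by
  refine Nat.Coprime.symm (Nat.coprime_of_dvd' fun q hq hd hh => ?_)
  have := Nat.minFac_le_of_dvd hq.two_le hh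
  have h2 := (Nat.minFac_prime h1).two_le
  have := Nat.le_of_dvd (by omega) hd
  omega

namespace IsMacdonaldPair

universe u

theorem mem_center {H : Type*} [Group H] {A B z : H} (hg : Subgroup.closure {A, B} = ⊤)
    (hA : Commute z A) (hB : Commute z B) : z ∈ Subgroup.center H := by
  have : Subgroup.closure {A, B} ≤ Subgroup.centralizer {z} := by
    rw [Subgroup.closure_le]
    rintro _ (rfl | rfl)
    · exact Subgroup.mem_centralizer_singleton_iff.2 hA.eq.symm
    · exact Subgroup.mem_centralizer_singleton_iff.2 hB.eq.symm
  rw [Subgroup.mem_center_iff]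
  intro g
  exact Subgroup.mem_centralizer_singleton_iff.1 (this (hg ▸ Subgroup.mem_top g))

/-- The action of `B` on the subgroup of prime order of `⟨A⟩` when `C ^ (h / p) = 1`. -/
theorem commute_pow_minFac {H : Type*} [Group H] {x : ℤ} {A B : H} (hM : IsMacdonaldPair x A B)
    {h : ℕ} (h0 : h ≠ 0) (h1 : h ≠ 1) (hA : A ^ h = 1) (hB : B ^ h = 1)
    (hC : rcomm A B ^ (h / h.minFac) = 1)
    (hx : ∀ p : ℕ, p.Prime → p ∣ h → (p : ℤ) ∣ x - 1) : Commute (A ^ (h / h.minFac)) B := by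
  have : Fact h.minFac.Prime := ⟨Nat.minFac_prime h1⟩
  obtain ⟨c, hc⟩ := dvd_powSum (x := x) (r := h / h.minFac) fun p hp hd =>
    hx p hp (hd.trans (Nat.div_dvd_of_dvd h.minFac_dvd))
  have e := hM.conj_pow_eq (h / h.minFac)
  rw [hC, one_mul, hc, zpow_mul, zpow_natCast] at e
  exact commute_of_conj_eq_zpow (by rw [← pow_mul, Nat.div_mul_cancel h.minFac_dvd, hA]) hB e h0
    (Nat.coprime_minFac_sub_one h1)

/-- Let `p` be the least prime factor of `h` and `r = h / p`. Then `h ∣ x ^ r - 1`, so `C ^ r` is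
central. Modulo the centre, `B` acts on `⟨A ^ r⟩`, of order dividing `p`, with order dividing `h`;
as `h` is coprime to `p - 1`, the action is trivial. So `A ^ r`, and likewise `B ^ r`, becomes
central, and two central quotients reduce `h` to `r`. -/
theorem isNilpotent_of_pow_eq_one (h : ℕ) : ∀ (H : Type u) [Group H] (x : ℤ) (A B : H),
    IsMacdonaldPair x A B → Subgroup.closure {A, B} = ⊤ → h ≠ 0 → A ^ h = 1 → B ^ h = 1 →
    (∀ p : ℕ, p.Prime → p ∣ h → (p : ℤ) ∣ x - 1) → Group.IsNilpotent H := by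
  induction h using Nat.strong_induction_on with
  | _ h ih =>
  intro H _ x A B hM hg h0 hA hB hx
  by_cases h1 : h = 1
  · rw [h1, pow_one] at hA hB
    have : Subsingleton H := by
      refine Subgroup.subsingleton_iff.1 (subsingleton_of_bot_eq_top ?_)
      rw [← hg, hA, hB]
      simp [← Subgroup.zpowers_eq_closure]
    infer_instance
  have hp := Nat.minFac_prime h1
  have hd := h.minFac_dvd
  set p := h.minFac with hpdef
  set r := h / p with hr
  have hrp : h = r * p := (Nat.div_mul_cancel hd).symm
  have hrd : r ∣ h := ⟨p, hrp⟩
  have hxr : (h : ℤ) ∣ x ^ r - 1 := by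
    refine dvd_trans ?_ (mul_sub_one_dvd_pow_sub_one r fun q hq hd => hx q hq (hd.trans hrd))
    rw [hrp]
    push_cast
    exact mul_dvd_mul_left _ (hx p hp hd)
  have hpow : ∀ a : H, a ^ h = 1 → a ^ x ^ r = a := by
    intro a ha
    obtain ⟨k, hk⟩ := hxr
    rw [show x ^ r = h * k + 1 by linarith, zpow_add_one, zpow_mul, zpow_natCast, ha, one_zpow,
      one_mul]
  have hCz : rcomm A B ^ r ∈ Subgroup.center H := by
    have s1 := hM.semiconj_pow_left r 1
    have s2 := hM.semiconj_pow_right r 1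
    rw [one_mul, zpow_one, hpow _ hA] at s1
    rw [one_mul, zpow_one, hpow _ hB] at s2
    exact mem_center hg s1 s2
  let f := QuotientGroup.mk' (Subgroup.center H)
  have hf : Function.Surjective f := QuotientGroup.mk'_surjective _
  have hM1 := hM.map f
  have hg1 := Subgroup.closure_map_pair_eq_top hg hf
  have hC1 : rcomm (f A) (f B) ^ r = 1 := by
    have : f (rcomm A B ^ r) = 1 := (QuotientGroup.eq_one_iff _).2 hCz
    simpa [rcomm] using this
  have hA1 : f A ^ h = 1 := by rw [← map_pow, hA, map_one]
  have hB1 : f B ^ h = 1 := by rw [← map_pow, hB, map_one]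
  have cA : f A ^ r ∈ Subgroup.center (H ⧸ Subgroup.center H) :=
    mem_center hg1 (Commute.pow_self _ _) (hM1.commute_pow_minFac h0 h1 hA1 hB1 hC1 hx)
  have cB : f B ^ r ∈ Subgroup.center (H ⧸ Subgroup.center H) := by
    refine mem_center hg1 (hM1.symm.commute_pow_minFac h0 h1 hB1 hA1 ?_ hx) (Commute.pow_self _ _)
    rw [rcomm_swap (f A), inv_pow, hC1, inv_one]
  let f' := QuotientGroup.mk' (Subgroup.center (H ⧸ Subgroup.center H))
  have hf' : Function.Surjective f' := QuotientGroup.mk'_surjective _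
  refine Group.of_quotient_center_nilpotent (Group.of_quotient_center_nilpotent ?_)
  refine ih r ?_ _ x (f' (f A)) (f' (f B)) (hM1.map f') (Subgroup.closure_map_pair_eq_top hg1 hf') ?_ ?_ ?_
    fun q hq hd => hx q hq (hd.trans hrd)
  · exact Nat.div_lt_self (Nat.pos_of_ne_zero h0) hp.one_lt
  · rintro h
    rw [h, zero_mul] at hrp
    exact h0 hrp
  · rw [← map_pow]; exact (QuotientGroup.eq_one_iff _).2 cA
  · rw [← map_pow]; exact (QuotientGroup.eq_one_iff _).2 cB

end IsMacdonaldPair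

/-! ### Torsion and nilpotency in general -/

/-- If a prime divides `x ^ (xʲ + j) - (x + x² + ⋯ + x ^ xʲ)` for every `j` and does not divide `x`,
then it divides `x - 1`. -/
theorem dvd_sub_one_of_forall_dvd {x q : ℕ} (hq : q.Prime) (hx : ¬ q ∣ x)
    (h : ∀ j : ℕ, (q : ℤ) ∣ (x : ℤ) ^ (x ^ j + j) - powSum x (x ^ j)) : (q : ℤ) ∣ x - 1 := by
  have : Fact q.Prime := ⟨hq⟩
  have hX : (x : ZMod q) ≠ 0 := by rwa [Ne, ZMod.natCast_eq_zero_iff]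
  rw [← ZMod.intCast_zmod_eq_zero_iff_dvd]
  push_cast
  by_contra hX1
  -- Multiplying by `x - 1` sums the geometric series.
  have rel : ∀ j : ℕ, (x : ZMod q) ^ x ^ j * ((x : ZMod q) ^ j * (x - 1) - x) = -x := by
    intro j
    have h1 := (ZMod.intCast_zmod_eq_zero_iff_dvd _ _).2 ((h j).mul_left (x - 1))
    rw [mul_sub, sub_one_mul_powSum, pow_add] at h1
    push_cast at h1
    linear_combination h1
  obtain ⟨d, hd0, modEq⟩ : ∃ d : ℕ, 0 < d ∧
      ∀ i j : ℕ, (x : ZMod q) ^ i = (x : ZMod q) ^ j ↔ i ≡ j [MOD d] := by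
    refine ⟨orderOf (Units.mk0 _ hX), orderOf_pos _, fun i j => ?_⟩
    rw [← pow_eq_pow_iff_modEq, Units.ext_iff]
    simp
  -- With `d` the order of `x` modulo `q`, `x ^ j` modulo `d` determines `x ^ x ^ j` modulo `q`,
  -- hence by `rel` also `x ^ j` modulo `q`, hence `j` modulo `d`.
  have inj : ∀ i j : ℕ, (x : ZMod d) ^ i = (x : ZMod d) ^ j → i ≡ j [MOD d] := by
    intro i j e
    have e1 : x ^ i ≡ x ^ j [MOD d] := by
      rw [← ZMod.natCast_eq_natCast_iff]; push_cast; exact e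
    have e2 : (x : ZMod q) ^ x ^ i = (x : ZMod q) ^ x ^ j := (modEq _ _).2 e1
    have ri := rel i
    rw [e2, ← rel j] at ri
    have e3 := mul_left_cancel₀ (pow_ne_zero _ hX) ri
    exact (modEq _ _).1 (mul_right_cancel₀ hX1 (sub_left_injective e3))
  have : NeZero d := ⟨hd0.ne'⟩
  have finj : Function.Injective fun i : Fin d => (x : ZMod d) ^ (i : ℕ) := by
    intro i j e
    exact Fin.ext (Nat.ModEq.eq_of_lt_of_lt (inj i j e) i.2 j.2)
  have fbij := (Fintype.bijective_iff_injective_and_card _).2 ⟨finj, by simp⟩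
  -- An injective self-map of a set of `d` elements hits 0. If `x ^ i` vanishes modulo `d`, so does
  -- `x ^ (i + 1)`; then `i ≡ i + 1`, forcing `x = 1` modulo `q`.
  obtain ⟨i, hi⟩ := fbij.2 0
  have := inj i (i + 1) (by rw [pow_succ]; simp only at hi; rw [hi, zero_mul])
  have h2 := (modEq _ _).2 this
  rw [pow_succ] at h2
  exact hX1 (sub_eq_zero.2 (mul_left_cancel₀ (pow_ne_zero _ hX)
    (h2.symm.trans (mul_one _).symm)))

namespace IsMacdonaldPair

variable {H : Type*} [Group H] {A B : H}

theorem mem_center_of_zpow_eq (hg : Subgroup.closure {A, B} = ⊤) {U k : ℤ}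
    (e : B ^ k = A ^ (-U)) : A ^ U ∈ Subgroup.center H := by
  refine mem_center hg (Commute.zpow_self A U) ?_
  rw [← Commute.inv_left_iff, ← zpow_neg, ← e]
  exact Commute.zpow_self B k

theorem zpow_mul_sub_one_eq_one {x : ℤ} (hM : IsMacdonaldPair x A B) {U : ℤ}
    (hU : A ^ U ∈ Subgroup.center H) : A ^ (U * (x - 1)) = 1 := by
  have h := (hM.semiconj_pow_left 1 U).eq
  rw [pow_one, pow_one, ← Subgroup.mem_center_iff.1 hU] at h
  have := mul_left_cancel h
  rw [mul_sub_one, zpow_sub, this, mul_inv_cancel]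

theorem isOfFinOrder_left {x : ℤ} (hM : IsMacdonaldPair x A B)
    (hg : Subgroup.closure {A, B} = ⊤) (hx : Odd x) (h1 : x ≠ 1) : IsOfFinOrder A := by
  suffices ∃ U k : ℤ, B ^ k = A ^ (-U) ∧ U * (x - 1) ≠ 0 by
    obtain ⟨U, k, e, h0⟩ := this
    exact isOfFinOrder_iff_zpow_eq_one.2
      ⟨_, h0, hM.zpow_mul_sub_one_eq_one (mem_center_of_zpow_eq hg e)⟩
  rcases lt_or_ge x 0 with hneg | hpos
  · obtain ⟨a, ha⟩ := Int.exists_eq_neg_ofNat hneg.le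
    refine ⟨_, _, hM.zpow_eq_of_neg ha, ?_⟩
    rw [mul_comm, mul_add, sub_one_mul_powSum,
      show x * (x ^ a - 1) + (x - 1) * x = x * (x ^ a + x - 2) by ring]
    have hodd : Odd a := by
      have : Odd (a : ℤ) := by rw [show (a : ℤ) = -x by omega]; exact hx.neg
      exact_mod_cast this
    have := hodd.pow_neg hneg
    exact mul_ne_zero hneg.ne (by omega)
  · lift x to ℕ using hpos
    refine ⟨_, _, hM.zpow_eq (j := 1) (m := x) (by simp), ?_⟩
    rw [mul_comm, mul_sub, sub_one_mul_powSum,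
      show ((x : ℤ) - 1) * x ^ (x + 1) - x * (x ^ x - 1) = x * (x ^ x * (x - 2) + 1) by ring]
    have hx3 : (3 : ℤ) ≤ x := by
      obtain ⟨k, hk⟩ := hx
      omega
    have h2 : (0 : ℤ) ≤ x - 2 := by omega
    positivity

/-- `A ^ x` is conjugate to `A`, so it has the same order. -/
theorem coprime_orderOf {x : ℕ} (hM : IsMacdonaldPair x A B) (hA : IsOfFinOrder A) :
    (orderOf A).Coprime x := by
  have e : orderOf (A ^ x) = orderOf A := by
    have h := hM.semiconj_left
    rw [zpow_natCast] at h
    exact h.orderOf_eq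
  rw [hA.orderOf_pow] at e
  have hpos := hA.orderOf_pos
  rw [Nat.div_eq_self] at e
  exact e.resolve_left hpos.ne'

theorem dvd_sub_one_of_dvd_orderOf_mod_center {x : ℕ} (hM : IsMacdonaldPair x A B)
    (hg : Subgroup.closure {A, B} = ⊤) (hA : IsOfFinOrder A) {q : ℕ} (hq : q.Prime)
    (hd : q ∣ orderOf (QuotientGroup.mk' (Subgroup.center H) A)) : (q : ℤ) ∣ x - 1 := by
  refine dvd_sub_one_of_forall_dvd hq (fun hqx => ?_) fun j => ?_
  · have := hd.trans (orderOf_map_dvd _ A)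
    have h1 := Nat.dvd_gcd this hqx
    rw [hM.coprime_orderOf hA, Nat.dvd_one] at h1
    exact hq.ne_one h1
  · refine (Int.natCast_dvd_natCast.2 hd).trans ?_
    rw [orderOf_dvd_iff_zpow_eq_one, ← map_zpow]
    exact (QuotientGroup.eq_one_iff _).2
      (mem_center_of_zpow_eq hg (hM.zpow_eq (j := j) (m := x ^ j) (by simp)))

theorem isNilpotent {x : ℕ} (hM : IsMacdonaldPair x A B)
    (hg : Subgroup.closure {A, B} = ⊤) (hA : IsOfFinOrder A) (hB : IsOfFinOrder B) :
    Group.IsNilpotent H := by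
  let f := QuotientGroup.mk' (Subgroup.center H)
  refine Group.of_quotient_center_nilpotent (isNilpotent_of_pow_eq_one
    ((orderOf (f A)).lcm (orderOf (f B))) _ x (f A) (f B) (hM.map f)
    (Subgroup.closure_map_pair_eq_top hg (QuotientGroup.mk'_surjective _)) ?_ ?_ ?_ ?_)
  · exact Nat.lcm_ne_zero (f.isOfFinOrder hA).orderOf_pos.ne' (f.isOfFinOrder hB).orderOf_pos.ne'
  · exact orderOf_dvd_iff_pow_eq_one.1 (Nat.dvd_lcm_left _ _)
  · exact orderOf_dvd_iff_pow_eq_one.1 (Nat.dvd_lcm_right _ _)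
  · intro p hp hd
    rcases (hp.dvd_lcm).1 hd with hd | hd
    · exact hM.dvd_sub_one_of_dvd_orderOf_mod_center hg hA hp hd
    · exact hM.symm.dvd_sub_one_of_dvd_orderOf_mod_center (Set.pair_comm A B ▸ hg) hB hp hd

end IsMacdonaldPair

/-! ### The upper bound 16 for 2-groups -/

theorem IsPGroup.exists_zpow_zpow_eq {p : ℕ} [Fact p.Prime] {H : Type*} [Group H]
    (hH : IsPGroup p H) (g : H) {u : ℤ} (hu : ¬ (p : ℤ) ∣ u) : ∃ v : ℤ, (g ^ u) ^ v = g := by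
  obtain ⟨k, hk⟩ := hH g
  have hp : Prime (p : ℤ) := Nat.prime_iff_prime_int.1 Fact.out
  obtain ⟨a, b, hab⟩ := ((hp.coprime_iff_not_dvd).2 hu).symm.pow_right (n := k)
  refine ⟨a, ?_⟩
  calc (g ^ u) ^ a = g ^ (a * u) * (g ^ p ^ k) ^ b := by
        rw [hk, one_zpow, mul_one, ← zpow_mul, mul_comm]
    _ = g := by
        rw [← zpow_natCast, ← zpow_mul, ← zpow_add, mul_comm _ b]
        push_cast
        rw [hab, zpow_one]

theorem IsPGroup.eq_one_of_zpow_eq_one {p : ℕ} [Fact p.Prime] {H : Type*} [Group H]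
    (hH : IsPGroup p H) {g : H} {u : ℤ} (hu : ¬ (p : ℤ) ∣ u) (h : g ^ u = 1) : g = 1 := by
  obtain ⟨v, hv⟩ := hH.exists_zpow_zpow_eq g hu
  rw [← hv, h, one_zpow]

theorem zpow_eq_zpow_of_modEq {H : Type*} [Group H] {g : H} {n : ℕ} (hg : g ^ n = 1) {i j : ℤ}
    (h : i ≡ j [ZMOD n]) : g ^ i = g ^ j := by
  obtain ⟨k, hk⟩ := h.symm.dvd
  rw [show i = j + n * k by omega, zpow_add, zpow_mul, zpow_natCast, hg, one_zpow, mul_one]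

namespace IsMacdonaldPair

variable {H : Type*} [Group H] {A B : H}

theorem pow_sub_powSum_modEq_two {x : ℕ} (hx : x % 4 = 3) :
    (x : ℤ) ^ (x + 1) - powSum x x ≡ 2 [ZMOD 4] := by
  have h1 : ((x : ℤ) : ZMod 4) = -1 := by
    have : ((x : ℤ) : ZMod 4) = ((-1 : ℤ) : ZMod 4) :=
      (ZMod.intCast_eq_intCast_iff _ _ _).2 (by rw [Int.ModEq]; omega)
    simpa using this
  have hodd : Odd x := Nat.odd_iff.2 (by omega)
  refine (ZMod.intCast_eq_intCast_iff _ _ 4).1 ?_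
  rw [powSum]
  push_cast
  push_cast at h1
  rw [h1, hodd.add_one.neg_one_pow, neg_one_geom_sum, if_neg (Nat.not_even_iff_odd.2 hodd)]
  decide

theorem pow_four_eq_one {x : ℕ} (hM : IsMacdonaldPair x A B) (hx : x % 4 = 3)
    (hg : Subgroup.closure {A, B} = ⊤) (hH : IsPGroup 2 H) : A ^ 4 = 1 := by
  have hU := pow_sub_powSum_modEq_two hx
  have e := hM.zpow_eq (j := 1) (m := x) (by simp)
  have hc := mem_center_of_zpow_eq hg e
  generalize (x : ℤ) ^ (x + 1) - powSum x x = U at *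
  have h1 := hM.zpow_mul_sub_one_eq_one hc
  rw [Int.ModEq] at hU
  obtain ⟨u, rfl⟩ : ∃ u, U = 2 * u := ⟨U / 2, by omega⟩
  obtain ⟨w, hw⟩ : ∃ w : ℤ, (x : ℤ) - 1 = 2 * w := ⟨((x : ℤ) - 1) / 2, by omega⟩
  have hu : ¬ ((2 : ℕ) : ℤ) ∣ u := by push_cast; omega
  have hw' : ¬ ((2 : ℕ) : ℤ) ∣ w := by push_cast; omega
  have h4 : ((A ^ (4 : ℕ)) ^ u) ^ w = 1 := by
    rw [← zpow_natCast A 4, ← zpow_mul, ← zpow_mul, ← h1, hw]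
    congr 1; push_cast; ring
  exact hH.eq_one_of_zpow_eq_one hu (hH.eq_one_of_zpow_eq_one hw' h4)

theorem sq_eq_sq {x : ℕ} (hM : IsMacdonaldPair x A B) (hx : x % 4 = 3) (hA : A ^ 4 = 1)
    (hB : B ^ 4 = 1) : A ^ 2 = B ^ 2 := by
  have hU := pow_sub_powSum_modEq_two hx
  have e := hM.zpow_eq (j := 1) (m := x) (by simp)
  have hodd : (x : ℤ) ^ (x + 1) ≡ 1 [ZMOD 2] := by
    have : (x : ℤ) ≡ 1 [ZMOD 2] := by rw [Int.ModEq]; omega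
    simpa using this.pow (x + 1)
  have h2 : ((x : ℤ) ^ (x + 1) - powSum x x) * (x : ℤ) ^ (x + 1) ≡ 2 [ZMOD 4] := by
    refine (hU.mul_right _).trans ?_
    simpa using hodd.mul_left' (c := 2)
  rw [zpow_eq_zpow_of_modEq hA (hU.neg), zpow_eq_zpow_of_modEq hB h2] at e
  rw [zpow_eq_zpow_of_modEq hA (j := 2) (by decide)] at e
  exact_mod_cast e.symm

/-- With `R = A B`, the power relations give the quaternion relations: `A` inverts `R`, `C = R ^ 2`
and `R ^ 4 = A ^ 2`. So every element is `R ^ i A ^ j` with `i < 8` and `j < 2`. -/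
theorem card_le_of_two_group {x : ℕ} (hM : IsMacdonaldPair x A B) (hx : x % 4 = 3)
    (hg : Subgroup.closure {A, B} = ⊤) (hH : IsPGroup 2 H) : Nat.card H ≤ 16 := by
  have hA := hM.pow_four_eq_one hx hg hH
  have hB := hM.symm.pow_four_eq_one hx (Set.pair_comm A B ▸ hg) hH
  have hAB := hM.sq_eq_sq hx hA hB
  set R := A * B with hR
  have hBR : B = A⁻¹ * R := by rw [hR, inv_mul_cancel_left]
  have hA2 : A ^ 2 = (A ^ 2)⁻¹ := by
    rw [eq_inv_iff_mul_eq_one, ← pow_add, hA]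
  have hAR : SemiconjBy A R R⁻¹ := by
    have : A * R = R⁻¹ * A := by
      calc A * R = A ^ 2 * B := by rw [hR, pow_two, mul_assoc]
        _ = (B ^ 2)⁻¹ * B := by rw [hA2, hAB]
        _ = R⁻¹ * A := by rw [hR]; group
    exact this
  have hC : rcomm A B = R ^ 2 := by
    calc rcomm A B = (A ^ 2)⁻¹ * (A * B⁻¹ * A * B) := by rw [rcomm]; group
      _ = A * A ^ 2 * B⁻¹ * A * B := by
        rw [← hA2, ← mul_assoc, ← mul_assoc, ← mul_assoc, ← pow_succ, pow_succ']
      _ = R ^ 2 := by rw [hAB, hR, pow_two, pow_two]; group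
  have hR4 : R ^ 4 = A ^ 2 := by
    have h := hM.semiconj_left.eq
    have h2 := (hAR.pow_right 2).eq
    rw [zpow_eq_zpow_of_modEq hA (j := -1) (by rw [Int.ModEq]; omega), hC, h2, zpow_neg_one] at h
    calc R ^ 4 = R ^ 2 * (R ^ 2 * A⁻¹) * A := by group
      _ = A ^ 2 := by rw [h, pow_two A]; group
  have hAz : ∀ i : ℤ, A * R ^ i = R ^ (-i) * A := fun i => by
    rw [zpow_neg, ← inv_zpow]; exact (hAR.zpow_right i).eq
  have hAz' : ∀ i : ℤ, A⁻¹ * R ^ i = R ^ (-i) * A⁻¹ := fun i => by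
    rw [inv_mul_eq_iff_eq_mul, ← mul_assoc, hAz, neg_neg, mul_inv_cancel_right]
  have all : ∀ g : H, ∃ i j : ℤ, g = R ^ i * A ^ j := by
    intro g
    have hmem : g ∈ Subgroup.closure {A, B} := hg ▸ Subgroup.mem_top g
    induction hmem using Subgroup.closure_induction_left with
    | one => exact ⟨0, 0, by simp⟩
    | mul_left y hy z _ ih =>
      obtain ⟨i, j, rfl⟩ := ih
      rcases hy with rfl | rfl
      · exact ⟨-i, 1 + j, by rw [← mul_assoc, hAz, mul_assoc, zpow_one_add]⟩
      · refine ⟨-(1 + i), -1 + j, ?_⟩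
        rw [hBR, mul_assoc, ← mul_assoc R, ← zpow_one_add, ← mul_assoc, hAz', mul_assoc, zpow_add,
          zpow_neg_one]
    | inv_mul_cancel y hy z _ ih =>
      obtain ⟨i, j, rfl⟩ := ih
      rcases hy with rfl | rfl
      · exact ⟨-i, -1 + j, by rw [← mul_assoc, hAz', mul_assoc, zpow_add, zpow_neg_one]⟩
      · refine ⟨-1 + -i, 1 + j, ?_⟩
        rw [hBR, mul_inv_rev, inv_inv, mul_assoc, ← mul_assoc A, hAz, mul_assoc, ← mul_assoc,
          zpow_add R, zpow_neg_one, zpow_one_add]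
  have hR8 : R ^ 8 = 1 := by
    rw [show 8 = 4 * 2 by norm_num, pow_mul, hR4, ← pow_mul, hA]
  let F : Fin 8 × Fin 2 → H := fun p => R ^ (p.1 : ℕ) * A ^ (p.2 : ℕ)
  have hF : Function.Surjective F := by
    intro g
    obtain ⟨i, j, rfl⟩ := all g
    -- Each factor `A ^ 2` is absorbed as `R ^ 4`.
    refine ⟨(⟨((i + 4 * (j / 2)) % 8).toNat, by omega⟩, ⟨(j % 2).toNat, by omega⟩), ?_⟩
    simp only [F]
    rw [← zpow_natCast, ← zpow_natCast, Int.toNat_of_nonneg (by omega),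
      Int.toNat_of_nonneg (by omega),
      zpow_eq_zpow_of_modEq hR8 (Int.mod_modEq (i + 4 * (j / 2)) 8), zpow_add, zpow_mul R]
    have : R ^ (4 : ℤ) = A ^ (2 : ℤ) := by exact_mod_cast hR4
    rw [this, ← zpow_mul, mul_assoc, ← zpow_add, Int.mul_ediv_add_emod]
  simpa using Nat.card_le_card_of_surjective F hF

end IsMacdonaldPair

/-! ### Central series of the quaternion group of order 16 -/

namespace QuaternionGroup

open scoped commutatorElement

/-- The subgroup of order two of the quaternion group of order 16. -/
def centralSubgroup : Subgroup (QuaternionGroup 4) where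
  carrier := {y | y = a 0 ∨ y = a 4}
  mul_mem' := by simp only [Set.mem_ofPred_eq]; decide
  one_mem' := Or.inl rfl
  inv_mem' := by simp only [Set.mem_ofPred_eq]; decide

/-- The subgroup of order four of the cyclic maximal subgroup of the quaternion group of
order 16. -/
def cyclicFour : Subgroup (QuaternionGroup 4) where
  carrier := {y | y = a 0 ∨ y = a 2 ∨ y = a 4 ∨ y = a 6}
  mul_mem' := by simp only [Set.mem_ofPred_eq]; decide
  one_mem' := Or.inl rfl
  inv_mem' := by simp only [Set.mem_ofPred_eq]; decide

theorem mem_centralSubgroup {y : QuaternionGroup 4} : y ∈ centralSubgroup ↔ y = a 0 ∨ y = a 4 :=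
  Iff.rfl

theorem mem_cyclicFour {y : QuaternionGroup 4} :
    y ∈ cyclicFour ↔ y = a 0 ∨ y = a 2 ∨ y = a 4 ∨ y = a 6 := Iff.rfl

theorem closure_sq : Subgroup.closure {(xa 0 : QuaternionGroup 4) ^ 2} = centralSubgroup := by
  apply le_antisymm
  · rw [Subgroup.closure_le, Set.singleton_subset_iff]
    exact Or.inr (by decide)
  · rintro y (rfl | rfl)
    · exact one_mem _
    · exact Subgroup.subset_closure (by simp only [Set.mem_singleton_iff]; decide)

theorem closure_sq_rcomm : Subgroup.closure {(xa 0 : QuaternionGroup 4) ^ 2,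
    rcomm (xa 0) (xa 5)} = cyclicFour := by
  have h2 : (a 2 : QuaternionGroup 4) ∈ Subgroup.closure {(xa 0 : QuaternionGroup 4) ^ 2,
      rcomm (xa 0) (xa 5)} :=
    Subgroup.subset_closure (Or.inr (by simp only [Set.mem_singleton_iff]; decide))
  apply le_antisymm
  · rw [Subgroup.closure_le]
    rintro _ (rfl | rfl)
    · exact Or.inr (Or.inr (Or.inl (by decide)))
    · exact Or.inr (Or.inl (by decide))
  · rintro y (rfl | rfl | rfl | rfl)
    · exact one_mem _
    · exact h2
    · exact Subgroup.pow_mem _ h2 2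
    · exact Subgroup.pow_mem _ h2 3

theorem center_four : Subgroup.center (QuaternionGroup 4) = centralSubgroup := by
  ext y
  rw [Subgroup.mem_center_iff, mem_centralSubgroup]
  revert y
  decide

theorem upperCentralSeries_two :
    Subgroup.upperCentralSeries (QuaternionGroup 4) 2 = cyclicFour := by
  ext y
  rw [Subgroup.mem_upperCentralSeries_succ_iff, Subgroup.upperCentralSeries_one, center_four]
  simp only [mem_centralSubgroup, mem_cyclicFour, commutatorElement_def]
  revert y
  decide

/-- The indexing starts with the whole group at 0, so index 1 is `γ₂`. -/
theorem lowerCentralSeries_one :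
    (⊤ : Subgroup (QuaternionGroup 4)).lowerCentralSeries 1 = cyclicFour := by
  rw [Subgroup.lowerCentralSeries_succ, Subgroup.lowerCentralSeries_zero]
  have h2 : (a 2 : QuaternionGroup 4) ∈
      ⁅(⊤ : Subgroup (QuaternionGroup 4)), (⊤ : Subgroup (QuaternionGroup 4))⁆ := by
    have := Subgroup.commutator_mem_commutator (Subgroup.mem_top (a 1 : QuaternionGroup 4))
      (Subgroup.mem_top (xa 0))
    rwa [show ⁅(a 1 : QuaternionGroup 4), xa 0⁆ = a 2 by rw [commutatorElement_def]; decide] at this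
  apply le_antisymm
  · rw [Subgroup.commutator_le]
    rintro y - z -
    rw [mem_cyclicFour, commutatorElement_def]
    revert y z
    decide
  · rintro y (rfl | rfl | rfl | rfl)
    · exact one_mem _
    · exact h2
    · exact Subgroup.pow_mem _ h2 2
    · exact Subgroup.pow_mem _ h2 3

theorem lowerCentralSeries_two :
    (⊤ : Subgroup (QuaternionGroup 4)).lowerCentralSeries 2 = centralSubgroup := by
  rw [Subgroup.lowerCentralSeries_succ, lowerCentralSeries_one]
  apply le_antisymm
  · rw [Subgroup.commutator_le]
    rintro y hy z -
    rw [mem_cyclicFour] at hy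
    rw [mem_centralSubgroup, commutatorElement_def]
    revert y z
    decide
  · rintro y (rfl | rfl)
    · exact one_mem _
    · have := Subgroup.commutator_mem_commutator (H₁ := cyclicFour) (Or.inr (Or.inl rfl))
        (Subgroup.mem_top (xa 0))
      rwa [show ⁅(a 2 : QuaternionGroup 4), xa 0⁆ = a 4 by
        rw [commutatorElement_def]; decide] at this

theorem lowerCentralSeries_three :
    (⊤ : Subgroup (QuaternionGroup 4)).lowerCentralSeries 3 = ⊥ := by
  rw [Subgroup.lowerCentralSeries_succ, lowerCentralSeries_two, eq_bot_iff,
    Subgroup.commutator_le]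
  rintro y hy z -
  rw [mem_centralSubgroup] at hy
  rw [Subgroup.mem_bot, commutatorElement_def]
  revert y z
  decide

theorem nilpotencyClass_four [Group.IsNilpotent (QuaternionGroup 4)] :
    Group.nilpotencyClass (QuaternionGroup 4) = 3 := by
  refine le_antisymm (Subgroup.lowerCentralSeries_eq_bot_iff_nilpotencyClass_le.1
    lowerCentralSeries_three) (Nat.lt_of_not_le fun h => ?_)
  have h2 := Subgroup.lowerCentralSeries_eq_bot_iff_nilpotencyClass_le.2 h
  rw [lowerCentralSeries_two] at h2
  have h4 : (a 4 : QuaternionGroup 4) ∈ centralSubgroup := Or.inr rfl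
  rw [h2, Subgroup.mem_bot] at h4
  revert h4
  decide

theorem isPGroup_four : IsPGroup 2 (QuaternionGroup 4) :=
  IsPGroup.of_card (n := 4) (by rw [Nat.card_eq_fintype_card, QuaternionGroup.card]; norm_num)

end QuaternionGroup

/-! ### Projection onto a Sylow subgroup -/

/-- In a finite nilpotent group every element agrees with an element of a given Sylow
`p`-subgroup under all homomorphisms to `p`-groups. -/
theorem Sylow.exists_map_eq {p : ℕ} [Fact p.Prime] {G : Type*} [Group G] [Finite G]
    [Group.IsNilpotent G] (J : Sylow p G) (g : G) :
    ∃ j : J, ∀ (K : Type) [Group K], IsPGroup p K → ∀ f : G →* K, f g = f j := by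
  have hJ : (J : Subgroup G).Normal := inferInstance
  have := J.unique_of_normal hJ
  obtain ⟨k, m, hm, hkm⟩ := Nat.exists_eq_pow_mul_and_not_dvd (orderOf_pos g).ne' p
    (Fact.out : p.Prime).ne_one
  have hp : Prime (p : ℤ) := Nat.prime_iff_prime_int.1 Fact.out
  have hm' : ¬ (p : ℤ) ∣ m := by rwa [Int.natCast_dvd_natCast]
  -- Bézout splits `g` into `g ^ (s p ^ k)`, which dies in every `p`-group, and its `p`-part `g ^ (t
  -- m)`.
  obtain ⟨s, t, hst⟩ := ((hp.coprime_iff_not_dvd).2 hm').pow_left (m := k)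
  have hg : g ^ ((p : ℤ) ^ k * m) = 1 := by
    rw [← orderOf_dvd_iff_zpow_eq_one, hkm]; push_cast; rfl
  have hmem : g ^ (t * m) ∈ J := by
    have hP : IsPGroup p (Subgroup.zpowers (g ^ (t * (m : ℤ)))) := by
      rintro ⟨y, hy⟩
      obtain ⟨i, rfl⟩ := Subgroup.mem_zpowers_iff.1 hy
      refine ⟨k, Subtype.ext ?_⟩
      simp only [SubmonoidClass.mk_pow, OneMemClass.coe_one]
      rw [← zpow_natCast, ← zpow_mul, ← zpow_mul]
      push_cast
      rw [show t * m * (i * p ^ k) = (p ^ k * m) * (t * i) by ring, zpow_mul, hg, one_zpow]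
    obtain ⟨Q, hQ⟩ := hP.exists_le_sylow
    rw [Subsingleton.elim J Q]
    exact hQ (Subgroup.mem_zpowers _)
  refine ⟨⟨_, hmem⟩, fun K _ hK f => ?_⟩
  have h1 : f (g ^ (s * (p : ℤ) ^ k)) = 1 := by
    refine hK.eq_one_of_zpow_eq_one hm' ?_
    rw [← map_zpow, ← zpow_mul, mul_assoc, mul_comm, zpow_mul, hg, one_zpow, map_one]
  calc f g = f (g ^ (s * (p : ℤ) ^ k) * g ^ (t * (m : ℤ))) := by
        rw [← zpow_add, hst, zpow_one]
    _ = _ := by rw [map_mul, h1, one_mul]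

theorem Sylow.exists_surjective {p : ℕ} [Fact p.Prime] {G : Type*} [Group G] [Finite G]
    [Group.IsNilpotent G] (J : Sylow p G) (hp : p ∣ Nat.card G) :
    ∃ f : G →* J, Function.Surjective f := by
  let e := Sylow.directProductOfNormal (G := G) fun {q} _ P => inferInstance
  let q : (Nat.card G).primeFactors :=
    ⟨p, Nat.mem_primeFactors.2 ⟨Fact.out, hp, Nat.card_pos.ne'⟩⟩
  let J' : Sylow (q : ℕ) G := J
  refine ⟨((Pi.evalMonoidHom (fun P : Sylow (q : ℕ) G => (P : Subgroup G)) J').comp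
    (Pi.evalMonoidHom (fun q : (Nat.card G).primeFactors =>
      ∀ P : Sylow (q : ℕ) G, (P : Subgroup G)) q)).comp e.symm.toMonoidHom, ?_⟩
  exact ((Function.surjective_eval J').comp (Function.surjective_eval q)).comp
    e.symm.surjective

/-! ### The Macdonald group and its quaternion quotient -/

namespace MacdonaldGroup

variable (α : ℤ)

theorem isMacdonaldPair : IsMacdonaldPair α (genA α) (genB α) := by
  constructor
  · have := PresentedGroup.one_of_mem (rels := macdonaldRels α) (Or.inl rfl)
    rw [map_mul, map_inv, mul_inv_eq_one] at this
    simpa [rconj, rcomm, genA, genB, PresentedGroup.of] using this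
  · have := PresentedGroup.one_of_mem (rels := macdonaldRels α) (Or.inr rfl)
    rw [map_mul, map_inv, mul_inv_eq_one] at this
    simpa [rconj, rcomm, genA, genB, PresentedGroup.of] using this

theorem closure_gen : Subgroup.closure {genA α, genB α} = ⊤ := by
  rw [← PresentedGroup.closure_range_of (macdonaldRels α)]
  congr 1
  ext y
  simp [genA, genB]

theorem exists_nat_isMacdonaldPair (hα : α % 4 = 3) : ∃ x : ℕ, x % 4 = 3 ∧
    IsMacdonaldPair x (genA α) (genB α) ∧
    IsOfFinOrder (genA α) ∧ IsOfFinOrder (genB α) := by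
  have hM := isMacdonaldPair α
  have hodd : Odd α := Int.odd_iff.2 (by omega)
  have h1 : α ≠ 1 := by omega
  have hA := hM.isOfFinOrder_left (closure_gen α) hodd h1
  have hB := hM.symm.isOfFinOrder_left (Set.pair_comm _ _ ▸ closure_gen α) hodd h1
  -- Reducing `α` modulo the orders keeps the relations; the factor 4 keeps the residue 3.
  set n : ℤ := 4 * (orderOf (genA α) * orderOf (genB α)) with hn
  have hn0 : 0 < n := by
    have := hA.orderOf_pos
    have := hB.orderOf_pos
    positivity
  have hx : ((α % n).toNat : ℤ) = α % n := Int.toNat_of_nonneg (Int.emod_nonneg _ hn0.ne')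
  have hmod : ((α % n).toNat : ℤ) ≡ α [ZMOD n] := by rw [hx]; exact Int.mod_modEq _ _
  refine ⟨(α % n).toNat, ?_, ⟨?_, ?_⟩, hA, hB⟩
  · have : ((α % n).toNat : ℤ) % 4 = α % 4 := hmod.of_mul_right _
    omega
  · rw [hM.left]
    exact zpow_eq_zpow_of_modEq (pow_orderOf_eq_one _)
      ((hmod.of_mul_left 4).of_mul_right _).symm
  · rw [hM.right]
    exact zpow_eq_zpow_of_modEq (pow_orderOf_eq_one _) ((hmod.of_mul_left 4).of_mul_left _).symm

variable {α}

theorem isMacdonaldPair_quaternionGroup (hα : α % 4 = 3) :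
    IsMacdonaldPair α (QuaternionGroup.xa 0 : QuaternionGroup 4) (QuaternionGroup.xa 5) := by
  constructor
  · rw [zpow_eq_zpow_of_modEq (QuaternionGroup.xa_pow_four _) (j := (3 : ℕ)) hα, zpow_natCast]
    decide
  · rw [zpow_eq_zpow_of_modEq (QuaternionGroup.xa_pow_four _) (j := (3 : ℕ)) hα, zpow_natCast]
    decide

theorem exists_hom_quaternionGroup (hα : α % 4 = 3) :
    ∃ φ : MacdonaldGroup α →* QuaternionGroup 4, Function.Surjective φ ∧
      φ (genA α) = QuaternionGroup.xa 0 ∧ φ (genB α) = QuaternionGroup.xa 5 := by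
  have hM := isMacdonaldPair_quaternionGroup hα
  -- The index 5 makes `A B = xa 0 * xa 5 = a 9 = a 1`, the generator of order 8.
  let f : Bool → QuaternionGroup 4 := fun b => cond b (QuaternionGroup.xa 5) (QuaternionGroup.xa 0)
  have hf : ∀ r ∈ macdonaldRels α, FreeGroup.lift f r = 1 := by
    rintro r (rfl | rfl)
    · rw [map_mul, map_inv, mul_inv_eq_one]
      simpa [rconj, rcomm, f] using hM.left
    · rw [map_mul, map_inv, mul_inv_eq_one]
      simpa [rconj, rcomm, f] using hM.right
  have hA : PresentedGroup.toGroup hf (genA α) = QuaternionGroup.xa 0 := PresentedGroup.toGroup.of hf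
  have hB : PresentedGroup.toGroup hf (genB α) = QuaternionGroup.xa 5 := PresentedGroup.toGroup.of hf
  refine ⟨PresentedGroup.toGroup hf, fun y => ?_, hA, hB⟩
  have : ∃ i : Fin 8, ∃ j : Fin 2, y = (QuaternionGroup.xa 0 * QuaternionGroup.xa 5) ^ (i : ℕ) *
      QuaternionGroup.xa 0 ^ (j : ℕ) := by
    revert y
    decide
  obtain ⟨i, j, rfl⟩ := this
  exact ⟨(genA α * genB α) ^ (i : ℕ) * genA α ^ (j : ℕ), by
    rw [map_mul, map_pow, map_pow, map_mul, hA, hB]⟩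

theorem isNilpotent (hα : α % 4 = 3) : Group.IsNilpotent (MacdonaldGroup α) := by
  obtain ⟨x, -, hM, hA, hB⟩ := exists_nat_isMacdonaldPair α hα
  exact hM.isNilpotent (closure_gen α) hA hB

theorem finite (hα : α % 4 = 3) : Finite (MacdonaldGroup α) := by
  obtain ⟨x, -, hM, hA, hB⟩ := exists_nat_isMacdonaldPair α hα
  have := isNilpotent hα
  exact Group.IsNilpotent.finite_of_closure_pair _ _ _ (closure_gen α) hA hB

end MacdonaldGroup

theorem emod_four_of_padicValInt {α : ℤ} (hα : padicValInt 2 (α - 1) = 1) : α % 4 = 3 := by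
  have h0 : α - 1 ≠ 0 := by
    intro h
    rw [h] at hα
    simp at hα
  have h2 := (padicValInt_dvd_iff (p := 2) 1 (α - 1)).2 (Or.inr hα.ge)
  have h4 : ¬ ((2 : ℕ) : ℤ) ^ 2 ∣ α - 1 := by
    rw [padicValInt_dvd_iff, hα]
    omega
  norm_num at h2 h4
  omega

open MacdonaldGroup QuaternionGroup in
theorem proposition8p2 (α : ℤ) (hα : padicValInt 2 (α - 1) = 1)
    (J : Sylow 2 (MacdonaldGroup α)) :
    Nonempty (J ≃* QuaternionGroup 4) ∧
    Group.IsNilpotent J ∧ Group.nilpotencyClass J = 3 ∧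
    Monoid.exponent J = 8 ∧
    ∃ π : MacdonaldGroup α →* J,
      IsSylowProjection J π ∧
      (∀ π' : MacdonaldGroup α →* J, IsSylowProjection J π' → π' = π) ∧
      let A : J := π (MacdonaldGroup.genA α)
      let B : J := π (MacdonaldGroup.genB α)
      let C : J := rcomm A B
      Subgroup.center J = Subgroup.closure {A ^ 2} ∧
      (⊤ : Subgroup J).lowerCentralSeries 2 = Subgroup.closure {A ^ 2} ∧
      Subgroup.upperCentralSeries J 2 = Subgroup.closure {A ^ 2, C} ∧
      (⊤ : Subgroup J).lowerCentralSeries 1 = Subgroup.closure {A ^ 2, C} := by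
  have hmod := emod_four_of_padicValInt hα
  have := MacdonaldGroup.finite hmod
  have := MacdonaldGroup.isNilpotent hmod
  obtain ⟨φ, hφ, hφA, hφB⟩ := exists_hom_quaternionGroup hmod
  have card16 : Nat.card (QuaternionGroup 4) = 16 := by
    rw [Nat.card_eq_fintype_card, QuaternionGroup.card]
  have hdvd : 2 ∣ Nat.card (MacdonaldGroup α) := by
    refine dvd_trans ?_ (Subgroup.card_dvd_of_surjective φ hφ)
    rw [card16]; norm_num
  have hcard : Nat.card J ≤ 16 := by
    obtain ⟨ρ, hρ⟩ := J.exists_surjective hdvd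
    obtain ⟨x, hx, hM, -, -⟩ := exists_nat_isMacdonaldPair α hmod
    exact (hM.map ρ).card_le_of_two_group hx
      (Subgroup.closure_map_pair_eq_top (closure_gen α) hρ) J.isPGroup'
  -- The target is a 2-group, so `φ` has the same image on `J` as on the whole group. With `hcard`,
  -- its restriction is an isomorphism `e`, and `e⁻¹ ∘ φ` is the projection.
  have hsurj : Function.Surjective (φ.comp (J : Subgroup (MacdonaldGroup α)).subtype) := by
    intro y
    obtain ⟨g, rfl⟩ := hφ y
    obtain ⟨j, hj⟩ := J.exists_map_eq g
    exact ⟨j, (hj _ isPGroup_four φ).symm⟩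
  have hbij := hsurj.bijective_of_nat_card_le (by rw [card16]; exact hcard)
  let e : J ≃* QuaternionGroup 4 := MulEquiv.ofBijective _ hbij
  have he : ∀ j : J, e j = φ j := fun _ => rfl
  have hproj : IsSylowProjection J (e.symm.toMonoidHom.comp φ) := fun j => by
    change e.symm (φ j) = j
    rw [← he, e.symm_apply_apply]
  have hN : Group.IsNilpotent J := J.isPGroup'.isNilpotent
  have hNQ : Group.IsNilpotent (QuaternionGroup 4) := Group.nilpotent_of_mulEquiv e
  refine ⟨⟨e⟩, hN, ?_, ?_, _, hproj, ?_, ?_⟩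
  · rw [← nilpotencyClass_four]
    exact le_antisymm
      (Group.nilpotencyClass_le_of_surjective e.symm.toMonoidHom e.symm.surjective)
      (Group.nilpotencyClass_le_of_surjective e.toMonoidHom e.surjective)
  · rw [Monoid.exponent_eq_of_mulEquiv e, QuaternionGroup.exponent]
    rfl
  · intro π' hπ'
    refine MonoidHom.ext fun g => ?_
    obtain ⟨j, hj⟩ := J.exists_map_eq g
    rw [hj _ J.isPGroup' π', hj _ J.isPGroup' (e.symm.toMonoidHom.comp φ), hπ', hproj]
  · intro A B C
    have hA : e A = xa 0 := by
      rw [← hφA]; exact e.apply_symm_apply _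
    have hB : e B = xa 5 := by
      rw [← hφB]; exact e.apply_symm_apply _
    have inj := Subgroup.map_injective (f := e.toMonoidHom) e.injective
    have hupper (n : ℕ) : (Subgroup.upperCentralSeries J n).map e.toMonoidHom =
        Subgroup.upperCentralSeries (QuaternionGroup 4) n := by
      rw [← Subgroup.comap_upperCentralSeries e n]
      exact Subgroup.map_comap_eq_self_of_surjective e.surjective _
    have hlower (n : ℕ) : ((⊤ : Subgroup J).lowerCentralSeries n).map e.toMonoidHom =
        (⊤ : Subgroup (QuaternionGroup 4)).lowerCentralSeries n := by
      rw [Subgroup.map_lowerCentralSeries, Subgroup.map_top_of_surjective _ e.surjective]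
    have hsq : (Subgroup.closure {A ^ 2}).map e.toMonoidHom = centralSubgroup := by
      rw [MonoidHom.map_closure, Set.image_singleton, ← closure_sq, ← hA]
      simp
    have hsqC : (Subgroup.closure {A ^ 2, C}).map e.toMonoidHom = cyclicFour := by
      rw [MonoidHom.map_closure, Set.image_pair, ← closure_sq_rcomm, ← hA, ← hB]
      simp [C, rcomm]
    refine ⟨inj ?_, inj ?_, inj ?_, inj ?_⟩
    · rw [hsq, ← Subgroup.upperCentralSeries_one, hupper, Subgroup.upperCentralSeries_one,
        center_four]
    · rw [hsq, hlower, QuaternionGroup.lowerCentralSeries_two]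
    · rw [hsqC, hupper, QuaternionGroup.upperCentralSeries_two]
    · rw [hsqC, hlower, QuaternionGroup.lowerCentralSeries_one]
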